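/- \textbf{Model.} A \emph{fully-parallel circuit} with $n$ inputs and $k$ output bits, in the Thompson model, is laid out on the planar grid of unit squares. Each computational node occupies one square. Each wire joins two nodes and runs through a path of squares, successive squares sharing a side, that contains no other node; two wires may meet in a square, but they never pass through the same side of a square. The computation takes $T\ge 1$ clock cycles, and in each cycle every wire carries one bit in each of its two directions. Nodes are deterministic and have memory: the bits a node sends depend only on its state, and its next state depends only on its state and the bits it receives. The $n$ inputs are loaded into $n$ distinct input nodes at the start, and the $k$ output bits are read from $k$ distinct output nodes at the end (a node may be both an input and an output node). The area $A$ is the number of squares occupied by nodes and wires, and the energy is $E=AT$. Fix $\varepsilon\in(0,1)$. A \emph{decoding scheme} is a sequence of such circuits (decoders) with block lengths $n_1<n_2<\cdots$ and numbers of decoded bits $k(n_1),k(n_2),\dots$, together with encoding functions $\{0,1\}^{k(n)}\to\{0,1\}^{n}$. The $k(n)$ source bits are independent fair coin flips, they are encoded, and the codeword is sent over $n$ uses of the binary erasure channel with erasure probability $\varepsilon$; the $n$ received symbols, each a bit or an erasure, are the inputs of the decoder. $P_{\mathrm e}(n)$ is the probability that the output of the decoder differs from the source. The scheme is \emph{exponentially-low-error}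 if, for some $c>0$, $P_{\mathrm e}(n)<e^{-cn}$ for all sufficiently large $n$ (among the block lengths), and $\lim_{n\to\infty}k(n)/n$ exists and is positive. \textbf{Statement.} Let $E(n)=A(n)T(n)$ and $T(n)$ be the energy and the number of clock cycles of the decoder of block length $n$ in an exponentially-low-error decoding scheme. \begin{enumerate} \item For every function $p$ with $p(n)\to\infty$ as $n\to\infty$ (in particular for every unbounded increasing function), $E(n)=\Omega\!\left(n^{3/2}/p(n)\right)$; that is, there is $C>0$ with $E(n)\ge C\,n^{3/2}/p(n)$ for all sufficiently large block lengths $n$. \item If $E(n)=O(n^{3/2})$, then $T(n)=\Omega(n^{1/2})$. \end{enumerate} -/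

import Mathlib

open Filter Topology

namespace Thompson

/-- The planar grid of unit squares, a square being named by its two integer coordinates.
Two squares are adjacent when they have a side in common. -/
def squareGrid : SimpleGraph (ℤ × ℤ) where
  Adj a b := |a.1 - b.1| + |a.2 - b.2| = 1
  symm := ⟨by
    intro a b h
    rw [abs_sub_comm b.1 a.1, abs_sub_comm b.2 a.2]
    exact h⟩
  loopless := ⟨by intro a h; simp at h⟩

/-- An output letter of the binary erasure channel: `some b` is the bit `b`, and `none` is
the erasure symbol. -/
abbrev Symbol : Type := Option Bool

/-- A fully-parallel circuit in the Thompson model, with `n` inputs (letters received from a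
binary erasure channel) and `k` output bits.

Layout: computational nodes occupy one square each; wires join two nodes and are routed
through squares that hold no other node. Two wires may meet in a square (a wire crossing),
but do not pass through the same side of a square.

Operation: the computation takes `cycles` clock cycles, and during a clock cycle each wire
carries one bit in each of its two directions. Nodes compute deterministically and have
memory; the next state of a node and the bits it sends depend only on its own state and on
the bits it receives. The `n` inputs are loaded into `n` distinct input nodes before the first
cycle, and the `k` output bits are read from `k` distinct output nodes after the last one.
A node may be both an input node and an output node. -/
structure Circuit (n k : ℕ) where
  /-- computational nodes -/
  Node : Type
  /-- wires -/
  Wire : Type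
  [fintypeNode : Fintype Node]
  [fintypeWire : Fintype Wire]
  /-- the square occupied by a node -/
  pos : Node → ℤ × ℤ
  pos_injective : Function.Injective pos
  /-- the two nodes joined by a wire -/
  ends : Wire → Bool → Node
  ends_ne : ∀ w, ends w false ≠ ends w true
  /-- the squares that a wire passes through, from one of its ends to the other -/
  route : ∀ w, squareGrid.Walk (pos (ends w false)) (pos (ends w true))
  route_isPath : ∀ w, (route w).IsPath
  route_avoids : ∀ w v, pos v ∈ (route w).support → ∃ b, ends w b = v
  route_disjoint : ∀ w w', w ≠ w' → (route w).edges.Disjoint (route w').edges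
  /-- the nodes into which the inputs are loaded -/
  inputNode : Fin n → Node
  inputNode_injective : Function.Injective inputNode
  /-- the nodes at which the outputs appear -/
  outputNode : Fin k → Node
  outputNode_injective : Function.Injective outputNode
  /-- the number of clock cycles -/
  cycles : ℕ
  cycles_pos : 0 < cycles
  /-- states of the nodes -/
  State : Type
  /-- the state in which a node starts, given the input loaded into it, if there is one -/
  init : (v : Node) → ({i : Fin n // inputNode i = v} → Symbol) → State
  /-- the bit that a node in a given state sends into each wire end attached to it -/
  send : (v : Node) → State → {e : Wire × Bool // ends e.1 e.2 = v} → Bool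
  /-- the next state of a node, given its state and the bit it receives from each wire end
  attached to it -/
  next : (v : Node) → State → ({e : Wire × Bool // ends e.1 e.2 = v} → Bool) → State
  /-- the bit read from an output node in a given state -/
  read : Fin k → State → Bool

attribute [instance] Circuit.fintypeNode Circuit.fintypeWire

namespace Circuit

/-- The states of all nodes after `t` clock cycles on the input `y`. The bit received from
the end `b` of a wire is the one sent in the same cycle by the node at its other end. -/
def stateAt {n k : ℕ} (D : Circuit n k) (y : Fin n → Symbol) : ℕ → D.Node → D.State
  | 0, v => D.init v fun i => y i.1
  | t + 1, v => D.next v (D.stateAt y t v) fun e =>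
      D.send (D.ends e.1.1 (!e.1.2)) (D.stateAt y t (D.ends e.1.1 (!e.1.2)))
        ⟨(e.1.1, !e.1.2), rfl⟩

/-- The function computed by the circuit. -/
def compute {n k : ℕ} (D : Circuit n k) (y : Fin n → Symbol) : Fin k → Bool :=
  fun j => D.read j (D.stateAt y D.cycles (D.outputNode j))

/-- The area `A`: the number of squares that hold a node, a wire or a wire crossing. -/
def area {n k : ℕ} (D : Circuit n k) : ℕ :=
  (Finset.univ.image D.pos ∪ Finset.univ.biUnion fun w => (D.route w).support.toFinset).card

/-- The energy `E = A T`. -/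
def energy {n k : ℕ} (D : Circuit n k) : ℕ := D.area * D.cycles

end Circuit

/-- The transition probability `P(y | x)` of the binary erasure channel with erasure
probability `ε`. -/
def erasureProb (ε : ℝ) (x : Bool) : Symbol → ℝ
  | none => ε
  | some b => if b = x then 1 - ε else 0

/-- The block error probability of a decoding function for the codebook given by the encoding
function `enc`: the `k` source bits are independent fair coin flips, the codeword is sent over
`n` uses of the binary erasure channel, and an error is a wrong estimate of the source. -/
noncomputable def blockErrorProb {n k : ℕ} (ε : ℝ) (enc : (Fin k → Bool) → Fin n → Bool)
    (dec : (Fin n → Symbol) → Fin k → Bool) : ℝ :=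
  ∑ x : Fin k → Bool, ∑ y : Fin n → Symbol,
    if dec y ≠ x then (1 / 2 : ℝ) ^ k * ∏ i, erasureProb ε (enc x i) (y i) else 0

/-- A (fully-parallel) decoding scheme: decoder circuits with increasing block lengths,
together with their codebooks. -/
structure DecodingScheme where
  /-- block lengths -/
  blockLength : ℕ → ℕ
  blockLength_strictMono : StrictMono blockLength
  /-- numbers of bits decoded -/
  numBits : ℕ → ℕ
  /-- codebooks, as encoding functions -/
  encode : (i : ℕ) → (Fin (numBits i) → Bool) → Fin (blockLength i) → Bool
  /-- decoders -/
  decoder : (i : ℕ) → Circuit (blockLength i) (numBits i)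

namespace DecodingScheme

/-- The block error probability of the `i`-th decoder over a binary erasure channel. -/
noncomputable def errorProb (S : DecodingScheme) (ε : ℝ) (i : ℕ) : ℝ :=
  blockErrorProb ε (S.encode i) (S.decoder i).compute

/-- `S` is an `f(n)`-decoding scheme for the erasure probability `ε`. -/
def IsSchemeFor (S : DecodingScheme) (ε : ℝ) (f : ℕ → ℝ) : Prop :=
  ∀ᶠ i in atTop, S.errorProb ε i < f (S.blockLength i)

/-- The scheme has asymptotic rate `R`. -/
def HasRate (S : DecodingScheme) (R : ℝ) : Prop :=
  Tendsto (fun i => (S.numBits i : ℝ) / (S.blockLength i : ℝ)) atTop (𝓝 R)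

/-- An exponentially-low-error decoding scheme: an `e ^ (-cn)`-decoding scheme for some
`c > 0`, with asymptotic rate greater than `0`. -/
def IsExponentiallyLowError (S : DecodingScheme) (ε : ℝ) : Prop :=
  (∃ c : ℝ, 0 < c ∧ S.IsSchemeFor ε fun n => Real.exp (-c * n)) ∧ ∃ R : ℝ, 0 < R ∧ S.HasRate R

end DecodingScheme

end Thompson

/-!
Order the squares of the grid by vertical strips of width `s ≈ √A`, then by rows, then by columns,
and cut the nodes into `M` groups of consecutive squares holding at most `m` input nodes each.
Within the strips a threshold of this order separates at most `s` vertical and one horizontal pair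
of neighbouring squares, and for a suitable offset the boundaries of the strips run through
`O(A / s)` occupied sides, so only `O(M √A)` wires join different groups.

If a group receives fewer than its number of output bits from outside, then at least half of the
sources are decoded wrongly once its inputs are erased, which happens with probability at least
`ε ^ m`. With an error probability below `ε ^ m / 2` every group thus receives as many bits as it
outputs, and adding up, `k ≤ O(M √A T)`. An error probability `e ^ (-cn)` allows `m` proportional to
`n`, that is, bounded `M`, whence `A T² = Ω(n²)`. Multiplying by the trivial bound `A ≥ n` gives
`(A T)² = Ω(n³)`, and dividing by `A T = O(n ^ (3/2))` gives `T = Ω(n ^ (1/2))`.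
-/

namespace Thompson

open Finset

/-! ### Erasure patterns -/

section Erasure

variable {n k : ℕ}

/-- The word received when `x` is sent and exactly the positions in `J` are erased. -/
def eraseAt (J : Finset (Fin n)) (x : Fin n → Bool) : Fin n → Symbol :=
  fun i => if i ∈ J then none else some (x i)

/-- The probability that `J` is exactly the set of erased positions. -/
def erasureSetProb (ε : ℝ) (J : Finset (Fin n)) : ℝ := ε ^ #J * (1 - ε) ^ #Jᶜ

lemma eraseAt_left_injective (x : Fin n → Bool) : Function.Injective (eraseAt · x) :=
  Function.LeftInverse.injective (g := fun y => univ.filter (y · = none)) fun J => by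
    ext i
    simp [eraseAt]

lemma erasureSetProb_nonneg {ε : ℝ} (h0 : 0 ≤ ε) (h1 : ε ≤ 1) (J : Finset (Fin n)) :
    0 ≤ erasureSetProb ε J :=
  mul_nonneg (pow_nonneg h0 _) (pow_nonneg (sub_nonneg.2 h1) _)

lemma prod_erasureProb_eraseAt (ε : ℝ) (J : Finset (Fin n)) (x : Fin n → Bool) :
    ∏ i, erasureProb ε (x i) (eraseAt J x i) = erasureSetProb ε J := by
  have hfactor : ∀ i, erasureProb ε (x i) (eraseAt J x i) = if i ∈ J then ε else 1 - ε := by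
    intro i
    by_cases hi : i ∈ J <;> simp [erasureProb, eraseAt, hi]
  simp only [hfactor, erasureSetProb, prod_ite, prod_const, filter_mem_eq_inter, univ_inter,
    filter_not, compl_eq_univ_sdiff]

lemma prod_erasureProb_eq_zero (ε : ℝ) {x : Fin n → Bool} {y : Fin n → Symbol}
    (hy : y ∉ Set.range (eraseAt · x)) : ∏ i, erasureProb ε (x i) (y i) = 0 := by
  contrapose! hy
  refine ⟨univ.filter (y · = none), funext fun i => ?_⟩
  have hi : erasureProb ε (x i) (y i) ≠ 0 := prod_ne_zero_iff.1 hy i (mem_univ i)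
  cases hyi : y i with
  | none => simp [eraseAt, hyi]
  | some b => simp_all [eraseAt, erasureProb]

lemma sum_erasureSetProb_superset (ε : ℝ) (I : Finset (Fin n)) :
    ∑ J with I ⊆ J, erasureSetProb ε J = ε ^ #I := by
  calc ∑ J with I ⊆ J, erasureSetProb ε J
      = ∑ J, (∏ _i ∈ J, ε) * ∏ i ∈ Jᶜ, if i ∈ I then 0 else 1 - ε := by
        rw [sum_filter]
        refine sum_congr rfl fun J _ => ?_
        split_ifs with hIJ
        · have hfactor : ∀ i ∈ Jᶜ, (if i ∈ I then 0 else 1 - ε) = 1 - ε :=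
            fun i hi => if_neg fun hiI => mem_compl.1 hi (hIJ hiI)
          simp only [erasureSetProb, prod_congr rfl hfactor, prod_const]
        · obtain ⟨i, hiI, hiJ⟩ := not_subset.1 hIJ
          have hzero : ∏ i ∈ Jᶜ, (if i ∈ I then 0 else 1 - ε) = 0 :=
            prod_eq_zero (mem_compl.2 hiJ) (if_pos hiI)
          rw [hzero, mul_zero]
    _ = ∏ i, (ε + if i ∈ I then 0 else 1 - ε) := (Fintype.prod_add _ _).symm
    _ = ∏ i, if i ∈ I then ε else 1 := prod_congr rfl fun i _ => by split_ifs <;> ring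
    _ = ε ^ #I := by rw [prod_ite_mem, univ_inter, prod_const]

lemma blockErrorProb_eq_sum_erasureSetProb (ε : ℝ) (enc : (Fin k → Bool) → Fin n → Bool)
    (dec : (Fin n → Symbol) → Fin k → Bool) :
    blockErrorProb ε enc dec =
      ∑ J, erasureSetProb ε J * (#{x | dec (eraseAt J (enc x)) ≠ x} / 2 ^ k) := by
  calc blockErrorProb ε enc dec
      = ∑ x, ∑ J, if dec (eraseAt J (enc x)) ≠ x then (1 / 2) ^ k * erasureSetProb ε J else 0 := by
        refine sum_congr rfl fun x _ => (Fintype.sum_of_injective _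
          (eraseAt_left_injective (enc x)) _ _ (fun y hy => ?_) fun J => ?_).symm
        · rw [prod_erasureProb_eq_zero ε hy, mul_zero, ite_self]
        · rw [prod_erasureProb_eraseAt]
    _ = _ := by
        rw [sum_comm]
        refine sum_congr rfl fun J _ => ?_
        rw [← sum_filter, sum_const, nsmul_eq_mul, one_div_pow]
        ring

lemma pow_div_two_le_blockErrorProb {ε : ℝ} (h0 : 0 ≤ ε) (h1 : ε ≤ 1)
    {enc : (Fin k → Bool) → Fin n → Bool} {dec : (Fin n → Symbol) → Fin k → Bool}
    {I : Finset (Fin n)}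
    (h : ∀ J, I ⊆ J → 2 ^ k ≤ 2 * #{x | dec (eraseAt J (enc x)) ≠ x}) :
    ε ^ #I / 2 ≤ blockErrorProb ε enc dec := by
  have hhalf : ∀ J, I ⊆ J → (1 / 2 : ℝ) ≤ #{x | dec (eraseAt J (enc x)) ≠ x} / 2 ^ k := by
    intro J hJ
    rw [div_le_div_iff₀ two_pos (by positivity), one_mul, mul_comm]
    exact_mod_cast h J hJ
  calc ε ^ #I / 2 = ∑ J with I ⊆ J, erasureSetProb ε J * (1 / 2) := by
        rw [← sum_mul, sum_erasureSetProb_superset, mul_one_div]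
    _ ≤ ∑ J with I ⊆ J, erasureSetProb ε J * (#{x | dec (eraseAt J (enc x)) ≠ x} / 2 ^ k) :=
        sum_le_sum fun J hJ => mul_le_mul_of_nonneg_left (hhalf J (mem_filter.1 hJ).2)
          (erasureSetProb_nonneg h0 h1 J)
    _ ≤ ∑ J, erasureSetProb ε J * (#{x | dec (eraseAt J (enc x)) ≠ x} / 2 ^ k) :=
        sum_le_sum_of_subset_of_nonneg (filter_subset _ _) fun J _ _ =>
          mul_nonneg (erasureSetProb_nonneg h0 h1 J) (by positivity)
    _ = blockErrorProb ε enc dec := (blockErrorProb_eq_sum_erasureSetProb ε enc dec).symm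

end Erasure

/-! ### Information flow between groups of nodes -/

namespace Circuit

variable {n k : ℕ} (D : Circuit n k)

/-- The bit that arrives in cycle `t` at the wire end `e`. -/
def received (y : Fin n → Symbol) (t : ℕ) (e : D.Wire × Bool) : Bool :=
  D.send (D.ends e.1 (!e.2)) (D.stateAt y t (D.ends e.1 (!e.2))) ⟨(e.1, !e.2), rfl⟩

/-- The wire ends at which the nodes satisfying `P` receive bits from the other nodes. -/
def entries (P : D.Node → Prop) [DecidablePred P] : Finset (D.Wire × Bool) :=
  {e | P (D.ends e.1 e.2) ∧ ¬ P (D.ends e.1 (!e.2))}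

/-- The wires that join nodes with different labels. -/
def cutWires {κ : Type*} [DecidableEq κ] (lab : D.Node → κ) : Finset D.Wire :=
  {w | lab (D.ends w false) ≠ lab (D.ends w true)}

section Group

variable (P : D.Node → Prop) [DecidablePred P]

lemma stateAt_congr {y y' : Fin n → Symbol} {T : ℕ} (hin : ∀ i, P (D.inputNode i) → y i = y' i)
    (hrec : ∀ t < T, ∀ e ∈ D.entries P, D.received y t e = D.received y' t e) :
    ∀ t ≤ T, ∀ v, P v → D.stateAt y t v = D.stateAt y' t v := by
  intro t
  induction t with
  | zero => exact fun _ v hv => congrArg (D.init v) (funext fun i => hin i.1 (i.2.symm ▸ hv))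
  | succ t ih =>
    intro ht v hv
    have hbits : ∀ e : {e : D.Wire × Bool // D.ends e.1 e.2 = v},
        D.received y t e.1 = D.received y' t e.1 := fun e => by
      by_cases hsender : P (D.ends e.1.1 (!e.1.2))
      · simp only [received, ih (by lia) _ hsender]
      · exact hrec t ht e.1 (mem_filter.2 ⟨mem_univ _, e.2.symm ▸ hv, hsender⟩)
    exact congrArg₂ (D.next v) (ih (by lia) v hv) (funext hbits)

lemma card_decoded_le (enc : (Fin k → Bool) → Fin n → Bool) {J : Finset (Fin n)}
    (hJ : ∀ i, P (D.inputNode i) → i ∈ J) :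
    #{x | D.compute (eraseAt J (enc x)) = x} ≤
      2 ^ (#{j | ¬ P (D.outputNode j)} + #(D.entries P) * D.cycles) := by
  classical
  -- A correctly decoded source is determined by its bits that are output elsewhere and by the
  -- bits that enter the group.
  let transcript (x : Fin k → Bool) : ({j // ¬ P (D.outputNode j)} → Bool) ×
      (D.entries P × Fin D.cycles → Bool) :=
    (fun j => x j.1, fun p => D.received (eraseAt J (enc x)) p.2 p.1)
  have hinj : Set.InjOn transcript {x | D.compute (eraseAt J (enc x)) = x} := by
    intro x hx x' hx' h
    obtain ⟨hout, hrec⟩ := Prod.ext_iff.1 h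
    have hstate := D.stateAt_congr P (y := eraseAt J (enc x)) (y' := eraseAt J (enc x'))
      (fun i hi => by simp only [eraseAt, if_pos (hJ i hi)])
      (fun t ht e he => congrFun hrec (⟨e, he⟩, ⟨t, ht⟩)) D.cycles le_rfl
    funext j
    by_cases hj : P (D.outputNode j)
    · rw [← congrFun hx j, ← congrFun hx' j, compute, compute, hstate _ hj]
    · exact congrFun hout ⟨j, hj⟩
  calc #{x | D.compute (eraseAt J (enc x)) = x}
      ≤ #(univ : Finset (({j // ¬ P (D.outputNode j)} → Bool) ×
          (D.entries P × Fin D.cycles → Bool))) :=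
        card_le_card_of_injOn transcript (fun _ _ => mem_coe.2 (mem_univ _)) (by simpa using hinj)
    _ = _ := by simp [Fintype.card_subtype, pow_add]

lemma two_pow_le_two_mul_card_not_decoded (enc : (Fin k → Bool) → Fin n → Bool)
    {J : Finset (Fin n)} (hJ : ∀ i, P (D.inputNode i) → i ∈ J)
    (hflow : #(D.entries P) * D.cycles < #{j | P (D.outputNode j)}) :
    2 ^ k ≤ 2 * #{x | D.compute (eraseAt J (enc x)) ≠ x} := by
  have houtputs : #{j | P (D.outputNode j)} + #{j | ¬ P (D.outputNode j)} = k := by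
    rw [card_filter_add_card_filter_not, card_univ, Fintype.card_fin]
  have hsources : #{x | D.compute (eraseAt J (enc x)) = x} +
      #{x | D.compute (eraseAt J (enc x)) ≠ x} = 2 ^ k := by
    rw [card_filter_add_card_filter_not, card_univ, Fintype.card_fun, Fintype.card_bool,
      Fintype.card_fin]
  have hpow : 2 * 2 ^ (#{j | ¬ P (D.outputNode j)} + #(D.entries P) * D.cycles) ≤ 2 ^ k := by
    rw [← pow_succ']
    exact Nat.pow_le_pow_right two_pos (by lia)
  linarith [D.card_decoded_le P enc hJ]

lemma card_outputs_le_of_blockErrorProb_lt {ε : ℝ} (h0 : 0 ≤ ε) (h1 : ε ≤ 1)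
    {enc : (Fin k → Bool) → Fin n → Bool}
    (herr : blockErrorProb ε enc D.compute < ε ^ #{i | P (D.inputNode i)} / 2) :
    #{j | P (D.outputNode j)} ≤ #(D.entries P) * D.cycles := by
  contrapose! herr
  exact pow_div_two_le_blockErrorProb h0 h1 fun J hJ =>
    D.two_pow_le_two_mul_card_not_decoded P enc (fun i hi => hJ (by simpa using hi)) herr

end Group

section Labelling

variable {κ : Type*} [DecidableEq κ] (lab : D.Node → κ)

lemma sum_card_entries_eq :
    ∑ l ∈ univ.image lab, #(D.entries fun v => lab v = l) = 2 * #(D.cutWires lab) := by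
  let cutEnds : Finset (D.Wire × Bool) := {e | lab (D.ends e.1 e.2) ≠ lab (D.ends e.1 (!e.2))}
  have hentries : ∀ l, D.entries (fun v => lab v = l) =
      {e ∈ cutEnds | lab (D.ends e.1 e.2) = l} := fun l => by
    ext e
    simp only [entries, cutEnds, mem_filter, mem_univ, true_and]
    grind
  have hends : cutEnds = D.cutWires lab ×ˢ univ := by
    ext ⟨w, b⟩
    cases b <;> simp [cutEnds, cutWires, eq_comm]
  simp only [hentries]
  rw [← card_eq_sum_card_fiberwise fun e _ => mem_coe.2 (mem_image_of_mem lab (mem_univ _)),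
    hends, card_product, card_univ, Fintype.card_bool, mul_comm]

lemma numBits_le_of_forall_card_outputs_le
    (h : ∀ l, #{j | lab (D.outputNode j) = l} ≤ #(D.entries fun v => lab v = l) * D.cycles) :
    k ≤ 2 * #(D.cutWires lab) * D.cycles := by
  calc k = #(univ : Finset (Fin k)) := by rw [card_univ, Fintype.card_fin]
    _ = ∑ l ∈ univ.image lab, #{j | lab (D.outputNode j) = l} :=
        card_eq_sum_card_fiberwise fun j _ => mem_coe.2 (mem_image_of_mem lab (mem_univ _))
    _ ≤ ∑ l ∈ univ.image lab, #(D.entries fun v => lab v = l) * D.cycles :=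
        sum_le_sum fun l _ => h l
    _ = 2 * #(D.cutWires lab) * D.cycles := by rw [← sum_mul, sum_card_entries_eq]

end Labelling

end Circuit

/-! ### Cutting an ordered family into groups of bounded size -/

section Group

variable {ι α : Type*} [Fintype ι] [LinearOrder α] (a : ι → α) (m : ℕ)

/-- The label of the place `c` when the family `a` is cut, in increasing order, into groups of `m`
members: the number of members that precede `c`, divided by `m`. -/
def groupLabel (c : α) : ℕ := #{i | a i < c} / m

lemma groupLabel_mono : Monotone (groupLabel a m) := fun _ _ h =>
  Nat.div_le_div_right (card_le_card (monotone_filter_right _ fun _ _ hi => hi.trans_le h))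

lemma groupLabel_le (c : α) : groupLabel a m c ≤ Fintype.card ι / m :=
  Nat.div_le_div_right (card_le_univ _)

lemma card_filter_lt_injective {a : ι → α} (ha : Function.Injective a) :
    Function.Injective fun j => #{i | a i < a j} := by
  have hmono : StrictMono fun c : Set.range a => #{i | a i < c.1} := fun c c' h => by
    obtain ⟨_, j, rfl⟩ := c
    refine card_lt_card (ssubset_iff_of_subset ?_ |>.2 ⟨j, ?_, ?_⟩)
    · exact monotone_filter_right _ fun _ _ hi => hi.trans h
    · exact mem_filter.2 ⟨mem_univ _, h⟩
    · simp
  exact hmono.injective.comp (Set.rangeFactorization_injective.2 ha)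

lemma card_groupLabel_eq_le {a : ι → α} (ha : Function.Injective a) {m : ℕ} (hm : 0 < m) (l : ℕ) :
    #{j | groupLabel a m (a j) = l} ≤ m := by
  calc #{j | groupLabel a m (a j) = l} ≤ #(Ico (l * m) (l * m + m)) :=
        card_le_card_of_injOn _ (fun j hj => by
          have hl := (Nat.div_eq_iff hm).1 (mem_filter.1 hj).2
          simp only [coe_Ico, Set.mem_Ico]
          lia) (card_filter_lt_injective ha).injOn
    _ = m := by simp

end Group

/-! ### Orders by strips on the grid -/

lemma card_filter_lt_le_mul {σ α κ : Type*} [Preorder α] {Q : Finset σ} {C : Finset κ}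
    {cls : σ → κ} {a b : σ → α} {f : α → ℕ} {M : ℕ} (hf : Monotone f) (hM : ∀ c, f c ≤ M)
    (hcls : ∀ z ∈ Q, cls z ∈ C)
    (hab : ∀ z ∈ Q, ∀ z' ∈ Q, z ≠ z' → cls z = cls z' → b z ≤ a z' ∨ b z' ≤ a z) :
    #{z ∈ Q | f (a z) < f (b z)} ≤ M * #C := by
  -- Within a class the intervals from `a z` to `b z` do not overlap, so `f` reaches each of its
  -- values in at most one of them.
  calc #{z ∈ Q | f (a z) < f (b z)} ≤ #(Icc 1 M ×ˢ C) := by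
        refine card_le_card_of_injOn (fun z => (f (b z), cls z)) (fun z hz => ?_) ?_
        · obtain ⟨hzQ, hlt⟩ := mem_filter.1 hz
          exact mem_product.2 ⟨mem_Icc.2 ⟨by lia, hM _⟩, hcls z hzQ⟩
        · intro z hz z' hz' heq
          obtain ⟨hzQ, hlt⟩ := mem_filter.1 hz
          obtain ⟨hzQ', hlt'⟩ := mem_filter.1 hz'
          obtain ⟨hfb : f (b z) = f (b z'), hcls'⟩ := Prod.ext_iff.1 heq
          by_contra hne
          rcases hab z hzQ z' hzQ' hne hcls' with hle | hle
          · linarith [hf hle]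
          · linarith [hf hle]
    _ = M * #C := by simp

/-- The square above `z`. -/
def up (z : ℤ × ℤ) : ℤ × ℤ := (z.1, z.2 + 1)

/-- The square to the right of `z`. -/
def right (z : ℤ × ℤ) : ℤ × ℤ := (z.1 + 1, z.2)

/-- The number of the vertical strip of width `s` that contains the square `z`, when the strip
number `0` starts in column `r`. -/
def stripIndex (s r : ℤ) (z : ℤ × ℤ) : ℤ := (z.1 - r) / s

/-- The place of the square `z` in the order by strips, then rows, then columns. -/
def stripKey (s r : ℤ) (z : ℤ × ℤ) : ℤ ×ₗ ℤ ×ₗ ℤ := toLex (stripIndex s r z, toLex (z.2, z.1))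

lemma eq_up_or_eq_right_of_adj {z z' : ℤ × ℤ} (h : squareGrid.Adj z z') :
    z' = up z ∨ z' = right z ∨ z = up z' ∨ z = right z' := by
  have h : |z.1 - z'.1| + |z.2 - z'.2| = 1 := h
  simp only [up, right, Prod.ext_iff]
  grind

lemma exists_cut_side_of_walk {κ : Type*} {u v : ℤ × ℤ} (p : squareGrid.Walk u v) {lab : ℤ × ℤ → κ}
    (h : lab u ≠ lab v) : ∃ z ∈ p.support,
      s(z, up z) ∈ p.edges ∧ lab z ≠ lab (up z) ∨
        s(z, right z) ∈ p.edges ∧ lab z ≠ lab (right z) := by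
  obtain ⟨d, hd, hfst, hsnd⟩ := p.exists_boundary_dart {z | lab z = lab u} rfl h.symm
  have hedge : s(d.fst, d.snd) ∈ p.edges := List.mem_map_of_mem hd
  have hne : lab d.fst ≠ lab d.snd := fun heq => hsnd (heq.symm.trans hfst)
  have hfst_mem := p.dart_fst_mem_support_of_mem_darts hd
  have hsnd_mem := p.dart_snd_mem_support_of_mem_darts hd
  rcases eq_up_or_eq_right_of_adj d.adj with h | h | h | h
  · exact ⟨d.fst, hfst_mem, .inl ⟨h ▸ hedge, h ▸ hne⟩⟩
  · exact ⟨d.fst, hfst_mem, .inr ⟨h ▸ hedge, h ▸ hne⟩⟩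
  · exact ⟨d.snd, hsnd_mem, .inl ⟨h ▸ Sym2.eq_swap ▸ hedge, h ▸ hne.symm⟩⟩
  · exact ⟨d.snd, hsnd_mem, .inr ⟨h ▸ Sym2.eq_swap ▸ hedge, h ▸ hne.symm⟩⟩

section Strip

variable {s r : ℤ} {z z' : ℤ × ℤ}

lemma stripKey_le_iff : stripKey s r z ≤ stripKey s r z' ↔ stripIndex s r z < stripIndex s r z' ∨
    stripIndex s r z = stripIndex s r z' ∧ (z.2 < z'.2 ∨ z.2 = z'.2 ∧ z.1 ≤ z'.1) := by
  simp only [stripKey, Prod.Lex.toLex_le_toLex]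

variable (s r) in
lemma stripKey_injective : Function.Injective (stripKey s r) := by
  intro z z' h
  simp only [stripKey, EmbeddingLike.apply_eq_iff_eq, Prod.mk.injEq] at h
  exact Prod.ext h.2.2 h.2.1

lemma stripKey_le_up : stripKey s r z ≤ stripKey s r (up z) := by
  simp [stripKey_le_iff, up, stripIndex]

lemma stripKey_le_right (h : stripIndex s r (right z) = stripIndex s r z) :
    stripKey s r z ≤ stripKey s r (right z) := by
  rw [stripKey_le_iff, h]
  simp [right]

lemma stripKey_up_le_or (hne : z ≠ z') (hmod : (z.1 - r) % s = (z'.1 - r) % s) :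
    stripKey s r (up z) ≤ stripKey s r z' ∨ stripKey s r (up z') ≤ stripKey s r z := by
  have hcol : stripIndex s r z = stripIndex s r z' → z.1 = z'.1 := fun h => by
    have := Int.mul_ediv_add_emod (z.1 - r) s
    have := Int.mul_ediv_add_emod (z'.1 - r) s
    simp only [stripIndex] at h
    rw [h] at *
    lia
  have hup : ∀ z, stripIndex s r (up z) = stripIndex s r z := fun _ => rfl
  have hne' : ¬ (z.1 = z'.1 ∧ z.2 = z'.2) := mt Prod.ext_iff.2 hne
  simp only [stripKey_le_iff, hup]
  simp only [up]
  lia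

lemma stripKey_right_le_or (hne : z ≠ z') (h : stripIndex s r (right z) = stripIndex s r z)
    (h' : stripIndex s r (right z') = stripIndex s r z') :
    stripKey s r (right z) ≤ stripKey s r z' ∨ stripKey s r (right z') ≤ stripKey s r z := by
  have hne' : ¬ (z.1 = z'.1 ∧ z.2 = z'.2) := mt Prod.ext_iff.2 hne
  simp only [stripKey_le_iff, h, h']
  simp only [right]
  lia

lemma emod_eq_of_stripIndex_right_ne (hs : 0 < s)
    (h : stripIndex s r (right z) ≠ stripIndex s r z) : (z.1 + 1) % s = r % s := by
  have hdvd : s ∣ z.1 + 1 - r := by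
    contrapose! h
    have hrem : (z.1 - r) % s ≠ s - 1 := fun hrem =>
      h ⟨(z.1 - r) / s + 1, by linarith [Int.mul_ediv_add_emod (z.1 - r) s]⟩
    rw [stripIndex, stripIndex, Int.ediv_eq_iff_of_pos hs, right]
    have := Int.mul_ediv_add_emod (z.1 - r) s
    have := Int.emod_nonneg (z.1 - r) hs.ne'
    have := Int.emod_lt_of_pos (z.1 - r) hs
    lia
  exact Int.emod_eq_emod_iff_emod_sub_eq_zero.2 (Int.emod_eq_zero_of_dvd hdvd)

end Strip

section Cut

variable {f : ℤ ×ₗ ℤ ×ₗ ℤ → ℕ} {M s : ℕ} {r : ℤ} (Q : Finset (ℤ × ℤ))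

lemma exists_card_stripIndex_right_ne_le (hs : 0 < s) {b : ℕ} (hQ : #Q ≤ s * b) :
    ∃ r : ℤ, #{z ∈ Q | stripIndex s r (right z) ≠ stripIndex s r z} ≤ b := by
  have hs' : (0 : ℤ) < s := by exact_mod_cast hs
  obtain ⟨r, hr, hcard⟩ := exists_card_fiber_le_of_card_le_mul (s := Q) (t := Ico (0 : ℤ) s)
    (n := b) (f := fun z => (z.1 + 1) % (s : ℤ)) (by simpa using hs) (by simpa using hQ)
  obtain ⟨hr0, hrs⟩ := mem_Ico.1 hr
  refine ⟨r, (card_le_card (monotone_filter_right _ fun z _ hz => ?_)).trans hcard⟩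
  exact (emod_eq_of_stripIndex_right_ne hs' hz).trans (Int.emod_eq_of_lt hr0 hrs)

lemma card_up_cut_le (hf : Monotone f) (hM : ∀ c, f c ≤ M) (hs : 0 < s) :
    #{z ∈ Q | f (stripKey s r z) ≠ f (stripKey s r (up z))} ≤ M * s := by
  have hs' : (0 : ℤ) < s := by exact_mod_cast hs
  calc #{z ∈ Q | f (stripKey s r z) ≠ f (stripKey s r (up z))}
      = #{z ∈ Q | f (stripKey s r z) < f (stripKey s r (up z))} := by
        simp only [(hf stripKey_le_up).lt_iff_ne]
    _ ≤ M * #(Ico (0 : ℤ) s) :=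
        card_filter_lt_le_mul (cls := fun z => (z.1 - r) % (s : ℤ)) hf hM
          (fun z _ => mem_Ico.2 ⟨Int.emod_nonneg _ hs'.ne', Int.emod_lt_of_pos _ hs'⟩)
          fun z _ z' _ hne hmod => stripKey_up_le_or hne hmod
    _ = M * s := by simp

lemma card_right_cut_le (hf : Monotone f) (hM : ∀ c, f c ≤ M) :
    #{z ∈ Q | f (stripKey s r z) ≠ f (stripKey s r (right z))} ≤
      #{z ∈ Q | stripIndex s r (right z) ≠ stripIndex s r z} + M := by
  let inner : Finset (ℤ × ℤ) := {z ∈ Q | stripIndex s r (right z) = stripIndex s r z}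
  have hinner : #{z ∈ inner | f (stripKey s r z) < f (stripKey s r (right z))} ≤ M * 1 :=
    card_filter_lt_le_mul (C := {()}) hf hM (fun _ _ => mem_singleton_self _)
      fun z hz z' hz' hne _ =>
        stripKey_right_le_or hne (mem_filter.1 hz).2 (mem_filter.1 hz').2
  rw [mul_one] at hinner
  refine (card_le_card fun z hz => ?_).trans ((card_union_le _ _).trans
    (Nat.add_le_add_left hinner _))
  obtain ⟨hzQ, hne⟩ := mem_filter.1 hz
  by_cases hz : stripIndex s r (right z) = stripIndex s r z
  · exact mem_union_right _ (mem_filter.2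
      ⟨mem_filter.2 ⟨hzQ, hz⟩, (hf (stripKey_le_right hz)).lt_of_ne hne⟩)
  · exact mem_union_left _ (mem_filter.2 ⟨hzQ, hz⟩)

end Cut

/-! ### The area-time tradeoff -/

namespace Circuit

variable {n k : ℕ} (D : Circuit n k)

/-- The squares that hold a node, a wire or a wire crossing. -/
def occupied : Finset (ℤ × ℤ) :=
  univ.image D.pos ∪ univ.biUnion fun w => (D.route w).support.toFinset

lemma mem_occupied_of_mem_support {w : D.Wire} {z : ℤ × ℤ} (hz : z ∈ (D.route w).support) :
    z ∈ D.occupied :=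
  mem_union_right _ (mem_biUnion.2 ⟨w, mem_univ _, List.mem_toFinset.2 hz⟩)

lemma numInputs_le_area : n ≤ D.area := by
  calc n = #(univ.map ⟨_, D.pos_injective.comp D.inputNode_injective⟩) := by simp
    _ ≤ D.area := card_le_card fun z hz => by
        obtain ⟨i, -, rfl⟩ := mem_map.1 hz
        exact mem_union_left _ (mem_image_of_mem _ (mem_univ _))

lemma card_cutWires_le {κ : Type*} [DecidableEq κ] (lab : ℤ × ℤ → κ) :
    #(D.cutWires fun v => lab (D.pos v)) ≤
      #{z ∈ D.occupied | lab z ≠ lab (up z)} + #{z ∈ D.occupied | lab z ≠ lab (right z)} := by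
  let cutSides : Finset (Sym2 (ℤ × ℤ)) :=
    {z ∈ D.occupied | lab z ≠ lab (up z)}.image (fun z => s(z, up z)) ∪
      {z ∈ D.occupied | lab z ≠ lab (right z)}.image (fun z => s(z, right z))
  calc #(D.cutWires fun v => lab (D.pos v)) ≤ #cutSides := by
        refine card_le_card_of_forall_subsingleton (fun w e => e ∈ (D.route w).edges)
          (fun w hw => ?_) fun e _ w hw w' hw' => ?_
        · obtain ⟨z, hz, h⟩ := exists_cut_side_of_walk (D.route w) (mem_filter.1 hw).2
          have hz := D.mem_occupied_of_mem_support hz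
          rcases h with ⟨hedge, hne⟩ | ⟨hedge, hne⟩
          · exact ⟨_, mem_union_left _ (mem_image_of_mem _ (mem_filter.2 ⟨hz, hne⟩)), hedge⟩
          · exact ⟨_, mem_union_right _ (mem_image_of_mem _ (mem_filter.2 ⟨hz, hne⟩)), hedge⟩
        · by_contra hne
          exact D.route_disjoint w w' hne hw.2 hw'.2
    _ ≤ _ := (card_union_le _ _).trans (add_le_add card_image_le card_image_le)

lemma exists_label_card_cutWires_le {m s b : ℕ} (hm : 0 < m) (hs : 0 < s) (hA : D.area ≤ s * b) :
    ∃ lab : D.Node → ℕ, (∀ l, #{i | lab (D.inputNode i) = l} ≤ m) ∧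
      #(D.cutWires lab) ≤ n / m * s + (b + n / m) := by
  obtain ⟨r, hr⟩ := exists_card_stripIndex_right_ne_le D.occupied hs hA
  let place (v : D.Node) : ℤ ×ₗ ℤ ×ₗ ℤ := stripKey s r (D.pos v)
  have hplace : Function.Injective (place ∘ D.inputNode) :=
    ((stripKey_injective s r).comp D.pos_injective).comp D.inputNode_injective
  let label := groupLabel (place ∘ D.inputNode) m
  have hmono : Monotone label := groupLabel_mono _ m
  have hle : ∀ c, label c ≤ n / m := by
    simpa only [Fintype.card_fin] using groupLabel_le (place ∘ D.inputNode) m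
  refine ⟨fun v => label (place v), card_groupLabel_eq_le hplace hm, ?_⟩
  calc _ ≤ _ := D.card_cutWires_le fun z => label (stripKey s r z)
    _ ≤ n / m * s + (b + n / m) := add_le_add (card_up_cut_le _ hmono hle hs)
        ((card_right_cut_le _ hmono hle).trans (Nat.add_le_add_right hr _))

lemma exists_label_sq_card_cutWires_le (hn : 0 < n) {m : ℕ} (hm : 0 < m) :
    ∃ lab : D.Node → ℕ, (∀ l, #{i | lab (D.inputNode i) = l} ≤ m) ∧
      #(D.cutWires lab) ^ 2 ≤ 9 * (n / m + 1) ^ 2 * D.area := by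
  set s := Nat.sqrt D.area
  have hs : 0 < s := Nat.sqrt_pos.2 (hn.trans_le D.numInputs_le_area)
  have hA : D.area ≤ s * (s + 2) := by linarith [Nat.lt_succ_sqrt D.area]
  obtain ⟨lab, hlab, hcut⟩ := D.exists_label_card_cutWires_le hm hs hA
  refine ⟨lab, hlab, ?_⟩
  have hwires : #(D.cutWires lab) ≤ 3 * (n / m + 1) * s := by
    have hgroups : n / m ≤ n / m * s := Nat.le_mul_of_pos_right _ hs
    rw [mul_assoc, add_one_mul]
    lia
  calc #(D.cutWires lab) ^ 2 ≤ (3 * (n / m + 1) * s) ^ 2 := Nat.pow_le_pow_left hwires 2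
    _ = 9 * (n / m + 1) ^ 2 * (s * s) := by ring
    _ ≤ 9 * (n / m + 1) ^ 2 * D.area := Nat.mul_le_mul_left _ (Nat.sqrt_le _)

lemma sq_numBits_le_area_mul_sq_cycles {ε : ℝ} (h0 : 0 ≤ ε) (h1 : ε ≤ 1)
    {enc : (Fin k → Bool) → Fin n → Bool} (hn : 0 < n) {m : ℕ} (hm : 0 < m)
    (herr : blockErrorProb ε enc D.compute < ε ^ m / 2) :
    k ^ 2 ≤ 36 * (n / m + 1) ^ 2 * (D.area * D.cycles ^ 2) := by
  obtain ⟨lab, hlab, hcut⟩ := D.exists_label_sq_card_cutWires_le hn hm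
  have hk : k ≤ 2 * #(D.cutWires lab) * D.cycles :=
    D.numBits_le_of_forall_card_outputs_le lab fun l =>
      D.card_outputs_le_of_blockErrorProb_lt (fun v => lab v = l) h0 h1 <| herr.trans_le <|
        div_le_div_of_nonneg_right (pow_le_pow_of_le_one h0 h1 (hlab l)) two_pos.le
  calc k ^ 2 ≤ (2 * #(D.cutWires lab) * D.cycles) ^ 2 := Nat.pow_le_pow_left hk 2
    _ = 4 * #(D.cutWires lab) ^ 2 * D.cycles ^ 2 := by ring
    _ ≤ 4 * (9 * (n / m + 1) ^ 2 * D.area) * D.cycles ^ 2 := by gcongr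
    _ = 36 * (n / m + 1) ^ 2 * (D.area * D.cycles ^ 2) := by ring

end Circuit

/-! ### Asymptotics -/

lemma exists_eventually_exp_neg_mul_le_pow_div_two {ε c : ℝ} (hε0 : 0 < ε) (hε1 : ε ≤ 1)
    (hc : 0 < c) :
    ∃ M : ℕ, 0 < M ∧ ∀ᶠ n : ℕ in atTop, Real.exp (-c * n) ≤ ε ^ (n / M + 1) / 2 := by
  have hlim : Tendsto (fun M : ℕ => Real.exp (-c * M)) atTop (𝓝 0) :=
    Real.tendsto_exp_atBot.comp
      (tendsto_natCast_atTop_atTop.const_mul_atTop_of_neg (neg_neg_of_pos hc))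
  obtain ⟨M, hM, hM0⟩ := ((hlim.eventually_le_const (by positivity : 0 < ε ^ 2 / 2)).and
    (eventually_gt_atTop 0)).exists
  refine ⟨M, hM0, (eventually_ge_atTop M).mono fun n hn => ?_⟩
  set q := n / M
  have hq : 1 ≤ q := Nat.div_pos hn hM0
  have hqn : (q : ℝ) * M ≤ n := by exact_mod_cast Nat.div_mul_le_self n M
  calc Real.exp (-c * n) ≤ Real.exp (q * (-c * M)) := Real.exp_le_exp.2 (by nlinarith)
    _ = Real.exp (-c * M) ^ q := Real.exp_nat_mul _ _
    _ ≤ (ε ^ 2 / 2) ^ q := by gcongr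
    _ = ε ^ (2 * q) * (1 / 2) ^ q := by rw [div_eq_mul_one_div, mul_pow, pow_mul]
    _ ≤ ε ^ (q + 1) * (1 / 2) ^ 1 := by
        gcongr ?_ * ?_
        · exact pow_le_pow_of_le_one hε0.le hε1 (by lia)
        · exact pow_le_pow_of_le_one (by norm_num) (by norm_num) hq
    _ = ε ^ (q + 1) / 2 := by ring

namespace DecodingScheme

variable {S : DecodingScheme} {ε : ℝ}

variable (S) in
lemma tendsto_blockLength_atTop : Tendsto S.blockLength atTop atTop :=
  S.blockLength_strictMono.tendsto_atTop

lemma HasRate.eventually_mul_le_numBits {R r : ℝ} (h : S.HasRate R) (hr : r < R) :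
    ∀ᶠ i in atTop, r * S.blockLength i ≤ S.numBits i := by
  filter_upwards [h.eventually_const_le hr, S.tendsto_blockLength_atTop.eventually_gt_atTop 0]
    with i hi hpos
  exact (le_div_iff₀ (by exact_mod_cast hpos)).1 hi

lemma exists_mul_sq_le_area_mul_sq_cycles (hε0 : 0 < ε) (hε1 : ε ≤ 1) {c R : ℝ} (hc : 0 < c)
    (herr : S.IsSchemeFor ε fun n => Real.exp (-c * n)) (hR : 0 < R)
    (hrate : ∀ᶠ i in atTop, R * S.blockLength i ≤ S.numBits i) :
    ∃ κ : ℝ, 0 < κ ∧ ∀ᶠ i in atTop,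
      κ * (S.blockLength i : ℝ) ^ 2 ≤ (S.decoder i).area * ((S.decoder i).cycles : ℝ) ^ 2 := by
  obtain ⟨M, hM0, hM⟩ := exists_eventually_exp_neg_mul_le_pow_div_two hε0 hε1 hc
  refine ⟨R ^ 2 / (36 * (M + 1) ^ 2), by positivity, ?_⟩
  filter_upwards [herr, hrate, S.tendsto_blockLength_atTop.eventually hM,
    S.tendsto_blockLength_atTop.eventually_gt_atTop 0] with i herr hrate hM hpos
  set n := S.blockLength i
  have hgroups : n / (n / M + 1) ≤ M :=
    Nat.div_le_of_le_mul ((Nat.lt_mul_div_succ n hM0).le.trans_eq (mul_comm _ _))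
  have hbits : (S.numBits i : ℝ) ^ 2 ≤ 36 * (M + 1) ^ 2 *
      ((S.decoder i).area * ((S.decoder i).cycles : ℝ) ^ 2) := by
    exact_mod_cast ((S.decoder i).sq_numBits_le_area_mul_sq_cycles hε0.le hε1 hpos
      (Nat.succ_pos (n / M)) (herr.trans_le hM)).trans (by gcongr)
  rw [div_mul_eq_mul_div, div_le_iff₀' (by positivity), ← mul_pow]
  exact (pow_le_pow_left₀ (by positivity) hrate 2).trans hbits

end DecodingScheme

section RealInequalities

variable {κ x A T : ℝ}

lemma sqrt_mul_rpow_le_mul (hκ : 0 ≤ κ) (hx : 0 ≤ x) (hT : 0 ≤ T) (hxA : x ≤ A)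
    (h : κ * x ^ 2 ≤ A * T ^ 2) : √κ * x ^ (3 / 2 : ℝ) ≤ A * T := by
  have hA : 0 ≤ A := hx.trans hxA
  have hrpow : (x ^ (3 / 2 : ℝ)) ^ 2 = x * x ^ 2 := by
    rw [← Real.rpow_mul_natCast hx, ← pow_succ', ← Real.rpow_natCast]
    norm_num
  refine le_of_sq_le_sq ?_ (mul_nonneg hA hT)
  calc (√κ * x ^ (3 / 2 : ℝ)) ^ 2 = x * (κ * x ^ 2) := by
        rw [mul_pow, Real.sq_sqrt hκ, hrpow, mul_left_comm]
    _ ≤ A * (A * T ^ 2) := by gcongr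
    _ = (A * T) ^ 2 := by ring

lemma div_mul_rpow_le {C : ℝ} (hC : 0 < C) (hx : 0 < x) (hT : 0 ≤ T)
    (h : κ * x ^ 2 ≤ A * T ^ 2) (hAT : A * T ≤ C * x ^ (3 / 2 : ℝ)) :
    κ / C * x ^ (1 / 2 : ℝ) ≤ T := by
  have hrpow : x ^ (1 / 2 : ℝ) * x ^ (3 / 2 : ℝ) = x ^ 2 := by
    rw [← Real.rpow_add hx, ← Real.rpow_natCast]
    norm_num
  rw [div_mul_eq_mul_div, div_le_iff₀ hC]
  refine le_of_mul_le_mul_right ?_ (Real.rpow_pos_of_pos hx (3 / 2))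
  calc κ * x ^ (1 / 2 : ℝ) * x ^ (3 / 2 : ℝ) = κ * x ^ 2 := by rw [mul_assoc, hrpow]
    _ ≤ A * T * T := h.trans_eq (by ring)
    _ ≤ C * x ^ (3 / 2 : ℝ) * T := by gcongr
    _ = T * C * x ^ (3 / 2 : ℝ) := by ring

end RealInequalities

lemma exists_eventually_mul_div_le {ι : Type*} {l : Filter ι} {u v p : ι → ℝ} (hu : ∀ i, 0 ≤ u i)
    (hp : ∀ᶠ i in l, 1 ≤ p i) (h : ∃ C, 0 < C ∧ ∀ᶠ i in l, C * u i ≤ v i) :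
    ∃ C, 0 < C ∧ ∀ᶠ i in l, C * (u i / p i) ≤ v i := by
  obtain ⟨C, hC, hle⟩ := h
  refine ⟨C, hC, ?_⟩
  filter_upwards [hp, hle] with i hpi hlei
  exact (mul_le_mul_of_nonneg_left (div_le_self (hu i) hpi) hC.le).trans hlei

end Thompson

theorem mainTheorem4_general {ε : ℝ} (hε0 : 0 < ε) (hε1 : ε ≤ 1) (S : Thompson.DecodingScheme)
    (herr : ∃ c : ℝ, 0 < c ∧ S.IsSchemeFor ε fun n => Real.exp (-c * n))
    (hrate : ∃ R : ℝ, 0 < R ∧ ∀ᶠ i in atTop, R * S.blockLength i ≤ S.numBits i) :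
    (∃ C : ℝ, 0 < C ∧ ∀ᶠ i in atTop,
      C * (S.blockLength i : ℝ) ^ (3 / 2 : ℝ) ≤ ((S.decoder i).energy : ℝ)) ∧
    ((∃ C : ℝ, 0 < C ∧ ∀ᶠ i in atTop,
        ((S.decoder i).energy : ℝ) ≤ C * (S.blockLength i : ℝ) ^ (3 / 2 : ℝ)) →
      ∃ C : ℝ, 0 < C ∧ ∀ᶠ i in atTop,
        C * (S.blockLength i : ℝ) ^ (1 / 2 : ℝ) ≤ ((S.decoder i).cycles : ℝ)) := by
  obtain ⟨c, hc, herr⟩ := herr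
  obtain ⟨R, hR, hrate⟩ := hrate
  obtain ⟨κ, hκ, hAT⟩ := S.exists_mul_sq_le_area_mul_sq_cycles hε0 hε1 hc herr hR hrate
  simp only [Thompson.Circuit.energy, Nat.cast_mul]
  constructor
  · refine ⟨√κ, Real.sqrt_pos.2 hκ, hAT.mono fun i hi => ?_⟩
    exact Thompson.sqrt_mul_rpow_le_mul hκ.le (Nat.cast_nonneg _) (Nat.cast_nonneg _)
      (by exact_mod_cast (S.decoder i).numInputs_le_area) hi
  · rintro ⟨C, hC, hE⟩
    refine ⟨κ / C, div_pos hκ hC, ?_⟩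
    filter_upwards [hAT, hE, S.tendsto_blockLength_atTop.eventually_gt_atTop 0] with i hi hEi hpos
    exact Thompson.div_mul_rpow_le hC (Nat.cast_pos.2 hpos) (Nat.cast_nonneg _) hi hEi

theorem mainTheorem4 (ε : ℝ) (hε0 : 0 < ε) (hε1 : ε < 1)
    (S : Thompson.DecodingScheme) (hS : S.IsExponentiallyLowError ε) :
    (∀ p : ℕ → ℝ, Tendsto p atTop atTop →
      ∃ C : ℝ, 0 < C ∧ ∀ᶠ i in atTop,
        C * ((S.blockLength i : ℝ) ^ (3 / 2 : ℝ) / p (S.blockLength i))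
          ≤ ((S.decoder i).energy : ℝ)) ∧
    ((∃ C : ℝ, 0 < C ∧ ∀ᶠ i in atTop,
        ((S.decoder i).energy : ℝ) ≤ C * (S.blockLength i : ℝ) ^ (3 / 2 : ℝ)) →
      ∃ C : ℝ, 0 < C ∧ ∀ᶠ i in atTop,
        C * (S.blockLength i : ℝ) ^ (1 / 2 : ℝ) ≤ ((S.decoder i).cycles : ℝ)) := by
  obtain ⟨herr, R, hR, hrate⟩ := hS
  have h := mainTheorem4_general hε0 hε1.le S herr
    ⟨R / 2, half_pos hR, hrate.eventually_mul_le_numBits (half_lt_self hR)⟩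
  exact ⟨fun p hp => Thompson.exists_eventually_mul_div_le (fun i => by positivity)
    ((hp.comp S.tendsto_blockLength_atTop).eventually_ge_atTop 1) h.1, h.2⟩
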